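/- Let $N\ge 1$ be an integer, $s\in(0,1)$, $T>0$, $S_T=\mathbb{R}^N\times(0,T)$ and $\bar S_T=\mathbb{R}^N\times[0,T]$. Let $\rho\in C(\mathbb{R}^N)$ with $\rho>0$ in $\mathbb{R}^N$, and suppose that there are $K>0$ and $\alpha\in\mathbb{R}$ with $$\rho(x)\ \ge\ K(1+|x|^2)^{-\alpha/2}\quad\text{for all }x\in\mathbb{R}^N,\qquad \alpha<2s .$$ Let $\mathcal L^s(\mathbb{R}^N)$ be the space of measurable $f:\mathbb{R}^N\to\mathbb{R}$ with $\|f\|_{\mathcal L^s}=\int_{\mathbb{R}^N}\frac{|f(x)|}{1+|x|^{N+2s}}\,dx<\infty$, and let $$(-\Delta)^s f(x)=C_{N,s}\,\mathrm{P.V.}\!\int_{\mathbb{R}^N}\frac{f(x)-f(y)}{|x-y|^{N+2s}}\,dy,\qquad C_{N,s}=\frac{2^{2s-1}\,2s\,\Gamma\!\left(\frac{N+2s}{2}\right)}{\pi^{N/2}\,\Gamma(1-s)} .$$ Let $u$ be a solution of the problem $$\rho\,\partial_t u+(-\Delta)^s u=0\ \text{ in }S_T,\qquad u=0\ \text{ in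 }\mathbb{R}^N\times\{0\},$$ in the following sense: $u\in C(\bar S_T)$; $u\in L^1((0,T),\mathcal L^s(\mathbb{R}^N))$; the derivative $\partial_t u$ exists everywhere in $S_T$, $\partial_t u\in C(S_T)$ and $\partial_t u\in L^1_{loc}(\bar S_T)$; for each $t\in(0,T]$ one has $u(\cdot,t)\in\mathcal L^s(\mathbb{R}^N)$ and, for some $\gamma>0$, $u(\cdot,t)\in C^{2s+\gamma}_{loc}(\mathbb{R}^N)$ if $s<\frac12$, or $u(\cdot,t)\in C^{1,2s+\gamma-1}_{loc}(\mathbb{R}^N)$ if $s\ge\frac12$; the equation $\rho(x)\,\partial_t u(x,t)+(-\Delta)^s u(\cdot,t)(x)=0$ holds at every $(x,t)\in S_T$; and $u(x,0)=0$ for all $x\in\mathbb{R}^N$. If, for some $\sigma\in(0,2s-\alpha)$ and $C>0$, $$|u(x,t)|\le C(1+|x|^2)^{\sigma/2}\quad\text{for all }(x,t)\in S_T,$$ then $u\equiv0$ in $S_T$. In particular, if $u$ is bounded in $S_T$, then $u\equiv 0$ in $S_T$ (no sign condition on $u$ is assumed). -/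

import Mathlib

open Set Filter Topology MeasureTheory

noncomputable section

namespace FracParabolic

/-- The Euclidean space `ℝ^N`. -/
abbrev E (N : ℕ) : Type := EuclideanSpace ℝ (Fin N)

/-- The open strip `S_T = ℝ^N × (0, T)`. -/
def strip (N : ℕ) (T : ℝ) : Set (E N × ℝ) := univ ×ˢ Ioo 0 T

/-- The closed strip `ℝ^N × [0, T]`. -/
def closedStrip (N : ℕ) (T : ℝ) : Set (E N × ℝ) := univ ×ˢ Icc 0 T

/-- Membership in `𝓛^s(ℝ^N)`: `f` is (Lebesgue) measurable and
`∫ |f(x)| / (1 + |x|^(N+2s)) dx < ∞`. -/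
def MemL {N : ℕ} (s : ℝ) (f : E N → ℝ) : Prop :=
  AEStronglyMeasurable f volume ∧
    Integrable (fun x : E N => |f x| / (1 + ‖x‖ ^ ((N : ℝ) + 2 * s))) volume

/-- Membership in `L¹((0, T), 𝓛^s(ℝ^N))`. By Tonelli's theorem this is (joint) measurability on
`S_T` together with `∫₀ᵀ ∫ |u(x,t)| / (1 + |x|^(N+2s)) dx dt < ∞`. -/
def MemL1L {N : ℕ} (s T : ℝ) (u : E N → ℝ → ℝ) : Prop :=
  AEStronglyMeasurable (Function.uncurry u) (volume.restrict (strip N T)) ∧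
    IntegrableOn (fun p : E N × ℝ => |u p.1 p.2| / (1 + ‖p.1‖ ^ ((N : ℝ) + 2 * s)))
      (strip N T) volume

/-- Local Hölder continuity with exponent `θ`: a Hölder bound on every compact set. -/
def LocHolder {X Y : Type*} [PseudoMetricSpace X] [PseudoMetricSpace Y] (θ : ℝ) (f : X → Y) :
    Prop :=
  ∀ k : Set X, IsCompact k → ∃ C : ℝ, ∀ x ∈ k, ∀ y ∈ k, dist (f x) (f y) ≤ C * dist x y ^ θ

/-- The regularity required of the spatial slices: for some `γ > 0`,
`f ∈ C^{2s+γ}_loc(ℝ^N)` if `s < 1/2`, and `f ∈ C^{1,2s+γ-1}_loc(ℝ^N)` if `s ≥ 1/2`.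
The class shrinks as `γ` grows, so `γ` may be taken so small that the
Hölder exponents `2s+γ`, respectively `2s+γ-1`, are at most `1`. -/
def SliceRegular {N : ℕ} (s : ℝ) (f : E N → ℝ) : Prop :=
  ∃ γ : ℝ, 0 < γ ∧
    ((s < 1 / 2 ∧ 2 * s + γ ≤ 1 ∧ LocHolder (2 * s + γ) f) ∨
     (1 / 2 ≤ s ∧ 2 * s + γ - 1 ≤ 1 ∧ ContDiff ℝ 1 f ∧ LocHolder (2 * s + γ - 1) (fderiv ℝ f)))

/-- The normalizing constant
`C_{N,s} = 2^(2s-1) 2s Γ((N+2s)/2) / (π^(N/2) Γ(1-s))`. -/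
def fracConst (N : ℕ) (s : ℝ) : ℝ :=
  (2 : ℝ) ^ (2 * s - 1) * (2 * s) * Real.Gamma (((N : ℝ) + 2 * s) / 2) /
    (Real.pi ^ ((N : ℝ) / 2) * Real.Gamma (1 - s))

/-- `(-Δ)^s f (x) = ℓ`, in the pointwise sense: the principal value
`C_{N,s} P.V. ∫ (f(x) - f(y)) / |x - y|^(N+2s) dy`, i.e. the limit as `ε → 0+` of the integrals over
`{y : |x - y| ≥ ε}`, exists and equals `ℓ`. (For `f ∈ 𝓛^s(ℝ^N)` the truncated integrals converge
absolutely.) -/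
def HasFracLaplacianAt {N : ℕ} (s : ℝ) (f : E N → ℝ) (x : E N) (ℓ : ℝ) : Prop :=
  Tendsto
    (fun ε : ℝ => fracConst N s *
      ∫ y in {y : E N | ε ≤ ‖x - y‖}, (f x - f y) / ‖x - y‖ ^ ((N : ℝ) + 2 * s))
    (𝓝[>] 0) (𝓝 ℓ)

/-- Assumption on the density: `ρ` is continuous and positive, and
`ρ(x) ≥ K (1 + |x|²)^(-α/2)` for some `K > 0`. -/
structure DensityAssumption {N : ℕ} (ρ : E N → ℝ) (α : ℝ) : Prop where
  continuous : Continuous ρ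
  pos : ∀ x, 0 < ρ x
  lower_bound : ∃ K : ℝ, 0 < K ∧ ∀ x, K * (1 + ‖x‖ ^ 2) ^ (-α / 2) ≤ ρ x

/-- `u` is a solution to the equation `ρ ∂ₜu + (-Δ)^s u = 0` in `S_T`. -/
structure IsSolutionEquation {N : ℕ} (s T : ℝ) (ρ : E N → ℝ) (u : E N → ℝ → ℝ) : Prop where
  continuousOn : ContinuousOn (Function.uncurry u) (strip N T)
  memL : ∀ t ∈ Ioc 0 T, MemL s (fun x => u x t)
  regular : ∀ t ∈ Ioc 0 T, SliceRegular s (fun x => u x t)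
  differentiable : ∀ x, ∀ t ∈ Ioo 0 T, DifferentiableAt ℝ (u x) t
  continuousOn_deriv : ContinuousOn (fun p : E N × ℝ => deriv (u p.1) p.2) (strip N T)
  equation : ∀ x, ∀ t ∈ Ioo 0 T,
    HasFracLaplacianAt s (fun y => u y t) x (-(ρ x * deriv (u x) t))

/-- `u` is a solution to the Cauchy problem `ρ ∂ₜu + (-Δ)^s u = 0` in `S_T`, `u = 0` on
`ℝ^N × {0}`. (In `deriv_locallyIntegrable` the values at `t = 0` and `t = T` are irrelevant,
as they concern a null set.) -/
structure IsSolution {N : ℕ} (s T : ℝ) (ρ : E N → ℝ) (u : E N → ℝ → ℝ) : Prop where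
  continuousOn_closed : ContinuousOn (Function.uncurry u) (closedStrip N T)
  deriv_locallyIntegrable :
    LocallyIntegrableOn (fun p : E N × ℝ => deriv (u p.1) p.2) (closedStrip N T) volume
  memL1L : MemL1L s T u
  solves : IsSolutionEquation s T ρ u
  initial : ∀ x, u x 0 = 0

end FracParabolic

end

/-! The proof rests on a local maximum principle, `PointwiseSolution.le_of_local_bounds`. On a ball
of radius `r` about `x₁`, `u` is compared with a paraboloid `B‖x - x₁‖²` plus an increasing function
of time. At a positive maximum of the difference, `u` is positive and touched from above by a
paraboloid. This bounds `(-Δ)^s u` below by its near part, of order `A r^(-2s)`, and its tail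
(`HasFracLaplacianAt.lower_bound`). The equation then bounds `ρ ∂ₜu` above, while maximality in time
makes `∂ₜu` too large. With `m` a lower bound of `ρ` on the ball, `A` an upper bound of `u` on the
doubled ball and `g` a bound of the tails, the result is `u(x₁, t) ≲ (A r^(-2s) T + ∫ g) / m`.

If `α ≥ 0`, take `A ~ r^σ`, `m ~ r^(-α)` and `g ~ r^(σ-2s)`: the right side is of order
`r^(σ+α-2s)`, which tends to `0` as `r → ∞`. The same argument for `-u` gives `u = 0`.

If `α ≤ 0`, then `σ ≥ 2s` is possible and the growth bound no longer controls the tails; the `𝓛^s`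
norm of the slice does. With `r` comparable to `1 + ‖x₁‖`, where `ρ ≳ r^(-α)`, the estimate is of
order `r^(σ+α-2s) + r^α`, so `u` is bounded. Since `ρ ≥ K` here, the first case with `α = σ = 0`
concludes. -/

noncomputable section

namespace FracParabolic

open Metric

/-! ### Radial integrals and translations -/

/-- The integral of the radial function `‖z‖ ^ (a - N)` over a radial set, in polar coordinates. -/
lemma integral_norm_rpow {N : ℕ} (hN : 1 ≤ N) (a : ℝ) {S : Set ℝ} (hS : MeasurableSet S)
    (hS0 : S ⊆ Ioi 0) :
    (IntegrableOn (fun y : ℝ => y ^ (a - 1)) S →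
      IntegrableOn (fun z : E N => ‖z‖ ^ (a - N)) {z | ‖z‖ ∈ S}) ∧
    ∫ z in {z : E N | ‖z‖ ∈ S}, ‖z‖ ^ (a - N) =
      N * volume.real (ball (0 : E N) 1) * ∫ y in S, y ^ (a - 1) := by
  have : Nonempty (Fin N) := ⟨⟨0, hN⟩⟩
  have : Nontrivial (E N) := inferInstance
  have hm : MeasurableSet {z : E N | ‖z‖ ∈ S} := measurable_norm hS
  have hind : ({z : E N | ‖z‖ ∈ S}.indicator fun z : E N => ‖z‖ ^ (a - N)) =
      fun z => S.indicator (fun y : ℝ => y ^ (a - N)) ‖z‖ := by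
    ext z
    by_cases h : ‖z‖ ∈ S <;> simp [indicator, h]
  have hpow : (fun y : ℝ => y ^ (N - 1) • S.indicator (fun y : ℝ => y ^ (a - N)) y) =
      S.indicator (fun y : ℝ => y ^ (a - 1)) := by
    ext y
    by_cases h : y ∈ S
    · have hy : 0 < y := hS0 h
      simp only [indicator_of_mem h, smul_eq_mul]
      rw [← Real.rpow_natCast, ← Real.rpow_add hy, Nat.cast_sub hN]
      congr 1
      push_cast
      ring
    · simp [h]
  constructor
  · intro h
    rw [← integrable_indicator_iff hm, hind, integrable_fun_norm_addHaar, finrank_euclideanSpace_fin,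
      hpow]
    exact ((integrable_indicator_iff hS).2 h).integrableOn
  · rw [← integral_indicator hm, hind, integral_fun_norm_addHaar, finrank_euclideanSpace_fin, hpow,
      setIntegral_indicator hS, inter_eq_self_of_subset_right hS0]
    simp [mul_assoc]

lemma integral_annulus_norm_rpow_le {N : ℕ} (hN : 1 ≤ N) {a : ℝ} (ha : 0 < a) {ε r : ℝ}
    (hε : 0 < ε) (hr : ε ≤ r) :
    IntegrableOn (fun z : E N => ‖z‖ ^ (a - N)) {z | ‖z‖ ∈ Ico ε r} ∧
    ∫ z in {z : E N | ‖z‖ ∈ Ico ε r}, ‖z‖ ^ (a - N) ≤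
      N * volume.real (ball (0 : E N) 1) * (r ^ a / a) := by
  have hS : Ico ε r ⊆ Ioi 0 := fun y hy => hε.trans_le hy.1
  obtain ⟨h1, h2⟩ := integral_norm_rpow hN a measurableSet_Ico hS
  constructor
  · apply h1
    have := intervalIntegral.intervalIntegrable_rpow' (a := ε) (b := r) (r := a - 1) (by linarith)
    rw [intervalIntegrable_iff_integrableOn_Ico_of_le hr] at this
    exact this
  · rw [h2, integral_Ico_eq_integral_Ioc, ← intervalIntegral.integral_of_le hr,
      integral_rpow (Or.inl (by linarith)), sub_add_cancel]
    gcongr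
    have := Real.rpow_nonneg hε.le a
    linarith

lemma integral_compl_ball_norm_rpow {N : ℕ} (hN : 1 ≤ N) {a : ℝ} (ha : a < 0) {r : ℝ}
    (hr : 0 < r) :
    IntegrableOn (fun z : E N => ‖z‖ ^ (a - N)) {z | ‖z‖ ∈ Ici r} ∧
    ∫ z in {z : E N | ‖z‖ ∈ Ici r}, ‖z‖ ^ (a - N) =
      N * volume.real (ball (0 : E N) 1) * (r ^ a / -a) := by
  have hS : Ici r ⊆ Ioi 0 := fun y hy => hr.trans_le hy
  obtain ⟨h1, h2⟩ := integral_norm_rpow hN a measurableSet_Ici hS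
  constructor
  · apply h1
    rw [integrableOn_Ici_iff_integrableOn_Ioi]
    exact integrableOn_Ioi_rpow_of_lt (by linarith) hr
  · rw [h2, integral_Ici_eq_integral_Ioi, integral_Ioi_rpow_of_lt (by linarith) hr, sub_add_cancel,
      neg_div, div_neg]

lemma setIntegral_comp_sub_left {N : ℕ} (x : E N) (S : Set ℝ) (hS : MeasurableSet S)
    (F : E N → ℝ) :
    ∫ y in {y : E N | ‖x - y‖ ∈ S}, F (x - y) = ∫ z in {z : E N | ‖z‖ ∈ S}, F z := by
  have hm : MeasurableSet {z : E N | ‖z‖ ∈ S} := measurable_norm hS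
  have hm' : MeasurableSet {y : E N | ‖x - y‖ ∈ S} :=
    (by fun_prop : Measurable fun y : E N => ‖x - y‖) hS
  rw [← integral_indicator hm, ← integral_indicator hm']
  exact integral_sub_left_eq_self ({z : E N | ‖z‖ ∈ S}.indicator F) volume x

lemma integrableOn_comp_sub_left {N : ℕ} (x : E N) (S : Set ℝ) (hS : MeasurableSet S)
    {F : E N → ℝ} (hF : IntegrableOn F {z : E N | ‖z‖ ∈ S}) :
    IntegrableOn (fun y => F (x - y)) {y : E N | ‖x - y‖ ∈ S} := by
  have hm : MeasurableSet {z : E N | ‖z‖ ∈ S} := measurable_norm hS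
  rw [← integrable_indicator_iff hm] at hF
  have hm' : MeasurableSet {y : E N | ‖x - y‖ ∈ S} :=
    (by fun_prop : Measurable fun y : E N => ‖x - y‖) hS
  rw [← integrable_indicator_iff hm']
  exact hF.comp_sub_left x

/-! ### The fractional Laplacian at a point of contact with a paraboloid -/

lemma fracConst_pos (N : ℕ) {s : ℝ} (hs0 : 0 < s) (hs1 : s < 1) : 0 < fracConst N s := by
  have h1 := Real.Gamma_pos_of_pos (s := ((N : ℝ) + 2 * s) / 2) (by positivity)
  have h2 := Real.Gamma_pos_of_pos (s := 1 - s) (by linarith)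
  unfold fracConst
  positivity

/-- The constant in `∫_{‖z‖ < r} ‖z‖ ^ (2 - N - 2s) dz = quadConst N s * r ^ (2 - 2s)`. -/
def quadConst (N : ℕ) (s : ℝ) : ℝ :=
  N * volume.real (ball (0 : E N) 1) / (2 - 2 * s)

lemma quadConst_nonneg (N : ℕ) {s : ℝ} (hs1 : s < 1) : 0 ≤ quadConst N s := by
  have : 0 < 2 - 2 * s := by linarith
  unfold quadConst
  positivity

/-- If `f` lies below a concave paraboloid touching it at `x`, within the ball of radius `r`, and
`f x ≥ 0`, then `(-Δ)^s f (x)` is bounded below. -/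
lemma HasFracLaplacianAt.lower_bound {N : ℕ} (hN : 1 ≤ N) {s : ℝ} (hs0 : 0 < s) (hs1 : s < 1)
    {f : E N → ℝ} {x : E N} {l : ℝ} (hf : HasFracLaplacianAt s f x l) {r B G : ℝ} (hr : 0 < r)
    (hB : 0 ≤ B) (b : E N)
    (hpar : ∀ y, ‖x - y‖ < r → inner ℝ b (x - y) - B * ‖x - y‖ ^ 2 ≤ f x - f y) (hfx : 0 ≤ f x)
    (hint : IntegrableOn (fun y => |f y| / ‖x - y‖ ^ ((N : ℝ) + 2 * s)) {y | r ≤ ‖x - y‖})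
    (htail : ∫ y in {y | r ≤ ‖x - y‖}, |f y| / ‖x - y‖ ^ ((N : ℝ) + 2 * s) ≤ G) :
    -(fracConst N s * (B * (quadConst N s * r ^ (2 - 2 * s)) + G)) ≤ l := by
  set p : ℝ := (N : ℝ) + 2 * s with hp
  have hc := fracConst_pos N hs0 hs1
  have hq := quadConst_nonneg N hs1
  have hG : 0 ≤ G := le_trans (integral_nonneg fun y => by positivity) htail
  refine ge_of_tendsto hf ?_
  filter_upwards [Ioo_mem_nhdsGT hr] with ε hε
  rw [← mul_neg]
  refine mul_le_mul_of_nonneg_left ?_ hc.le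
  have hmn : Measurable fun y : E N => ‖x - y‖ :=
    measurable_norm.comp (measurable_const.sub measurable_id)
  -- Without integrability the Bochner integral is `0` by convention, and the asserted bound is
  -- nonpositive.
  by_cases hI : IntegrableOn (fun y => (f x - f y) / ‖x - y‖ ^ p) {y | ε ≤ ‖x - y‖}
  swap
  · rw [integral_undef hI]
    have : 0 ≤ B * (quadConst N s * r ^ (2 - 2 * s)) := by positivity
    linarith
  have hsplit : {y : E N | ε ≤ ‖x - y‖} = {y | ‖x - y‖ ∈ Ico ε r} ∪ {y | ‖x - y‖ ∈ Ici r} := by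
    ext y
    simp only [mem_ofPred_eq, mem_union, mem_Ico, mem_Ici]
    constructor
    · intro h
      rcases lt_or_ge ‖x - y‖ r with h' | h'
      · exact Or.inl ⟨h, h'⟩
      · exact Or.inr h'
    · rintro (h | h)
      · exact h.1
      · exact hε.2.le.trans h
  have hdisj : Disjoint {y : E N | ‖x - y‖ ∈ Ico ε r} {y | ‖x - y‖ ∈ Ici r} := by
    rw [Set.disjoint_left]
    intro y h1 h2
    exact absurd h1.2 (not_lt.2 h2)
  rw [hsplit] at hI ⊢
  rw [setIntegral_union hdisj (hmn measurableSet_Ici) hI.left_of_union hI.right_of_union]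
  have hlinInt : IntegrableOn (fun z : E N => inner ℝ b z / ‖z‖ ^ p) {z | ‖z‖ ∈ Ico ε r} := by
    have hfin : volume {z : E N | ‖z‖ ∈ Ico ε r} ≠ ⊤ := by
      refine ((measure_mono ?_).trans_lt (measure_ball_lt_top (x := (0 : E N)) (r := r))).ne
      intro z hz
      simpa using hz.2
    refine Measure.integrableOn_of_bounded (M := ‖b‖ * r / ε ^ p) hfin ?_ ?_
    · exact (Measurable.div (by fun_prop) (measurable_norm.pow_const p)).aestronglyMeasurable
    · refine (ae_restrict_iff' (measurable_norm measurableSet_Ico)).2 (.of_forall fun z hz => ?_)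
      have hz1 : ε ≤ ‖z‖ := hz.1
      have hz2 : ‖z‖ < r := hz.2
      have hεp : 0 < ε ^ p := Real.rpow_pos_of_pos hε.1 _
      rw [norm_div, Real.norm_of_nonneg (by positivity : 0 ≤ ‖z‖ ^ p)]
      have := hε.1
      refine div_le_div₀ (by positivity) ((norm_inner_le_norm b z).trans (by gcongr)) hεp ?_
      exact Real.rpow_le_rpow hε.1.le hz1 (by positivity)
  -- The linear part of the paraboloid is odd, so it cancels on the symmetric annulus.
  have hlin : ∫ z in {z : E N | ‖z‖ ∈ Ico ε r}, inner ℝ b z / ‖z‖ ^ p = 0 := by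
    have hm : MeasurableSet {z : E N | ‖z‖ ∈ Ico ε r} := measurable_norm measurableSet_Ico
    have h := integral_neg_eq_self
      ({z : E N | ‖z‖ ∈ Ico ε r}.indicator fun z => inner ℝ b z / ‖z‖ ^ p) volume
    have h' : ∀ z : E N, ({z : E N | ‖z‖ ∈ Ico ε r}.indicator fun z => inner ℝ b z / ‖z‖ ^ p) (-z) =
        -({z : E N | ‖z‖ ∈ Ico ε r}.indicator fun z => inner ℝ b z / ‖z‖ ^ p) z := by
      intro z
      by_cases hz : ‖z‖ ∈ Ico ε r
      · simp only [indicator, mem_ofPred_eq, norm_neg, hz, if_true, inner_neg_right]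
        ring
      · simp only [indicator, mem_ofPred_eq, norm_neg, hz, if_false, neg_zero]
    simp_rw [h', integral_neg] at h
    rw [integral_indicator hm] at h
    linarith
  obtain ⟨hquadInt, hquad⟩ := integral_annulus_norm_rpow_le hN (a := 2 - 2 * s) (by linarith)
    hε.1 hε.2.le
  have h1 : -(B * (quadConst N s * r ^ (2 - 2 * s))) ≤
      ∫ y in {y | ‖x - y‖ ∈ Ico ε r}, (f x - f y) / ‖x - y‖ ^ p := by
    set F : E N → ℝ := fun z => inner ℝ b z / ‖z‖ ^ p - B * ‖z‖ ^ (2 - 2 * s - N) with hF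
    have hFint : IntegrableOn F {z : E N | ‖z‖ ∈ Ico ε r} :=
      hlinInt.sub (hquadInt.const_mul B)
    calc -(B * (quadConst N s * r ^ (2 - 2 * s)))
        ≤ ∫ z in {z : E N | ‖z‖ ∈ Ico ε r}, F z := by
          rw [integral_sub hlinInt (hquadInt.const_mul B), hlin, integral_const_mul, zero_sub]
          refine neg_le_neg (mul_le_mul_of_nonneg_left (hquad.trans_eq ?_) hB)
          unfold quadConst
          ring
      _ = ∫ y in {y | ‖x - y‖ ∈ Ico ε r}, F (x - y) :=
          (setIntegral_comp_sub_left x _ measurableSet_Ico F).symm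
      _ ≤ _ := by
          refine setIntegral_mono_on (integrableOn_comp_sub_left x _ measurableSet_Ico hFint)
            hI.left_of_union (hmn measurableSet_Ico) fun y hy => ?_
          have hpos : 0 < ‖x - y‖ := hε.1.trans_le hy.1
          have e : ‖x - y‖ ^ (2 - 2 * s - N) = ‖x - y‖ ^ 2 / ‖x - y‖ ^ p := by
            rw [← Real.rpow_natCast, ← Real.rpow_sub hpos]
            congr 1
            rw [hp]
            push_cast
            ring
          simp only [hF, e]
          rw [mul_div_assoc', ← sub_div]
          exact div_le_div_of_nonneg_right (hpar y hy.2) (by positivity)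
  have h2 : -G ≤ ∫ y in {y | ‖x - y‖ ∈ Ici r}, (f x - f y) / ‖x - y‖ ^ p := by
    refine (neg_le_neg htail).trans ?_
    rw [← integral_neg]
    refine setIntegral_mono_on hint.neg hI.right_of_union (hmn measurableSet_Ici) fun y hy => ?_
    rw [← neg_div]
    gcongr
    have := le_abs_self (f y)
    linarith
  linarith

/-! ### Pointwise solutions and the symmetry `u ↦ -u` -/

/-- The pointwise part of the notion of solution. -/
structure PointwiseSolution {N : ℕ} (s T : ℝ) (ρ : E N → ℝ) (u : E N → ℝ → ℝ) : Prop where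
  continuousOn : ContinuousOn (Function.uncurry u) (closedStrip N T)
  differentiable : ∀ x, ∀ t ∈ Ioo 0 T, DifferentiableAt ℝ (u x) t
  equation : ∀ x, ∀ t ∈ Ioo 0 T,
    HasFracLaplacianAt s (fun y => u y t) x (-(ρ x * deriv (u x) t))
  initial : ∀ x, u x 0 = 0

lemma IsSolution.pointwise {N : ℕ} {s T : ℝ} {ρ : E N → ℝ} {u : E N → ℝ → ℝ}
    (hu : IsSolution s T ρ u) : PointwiseSolution s T ρ u :=
  ⟨hu.continuousOn_closed, hu.solves.differentiable, hu.solves.equation, hu.initial⟩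

lemma HasFracLaplacianAt.neg {N : ℕ} {s : ℝ} {f : E N → ℝ} {x : E N} {l : ℝ}
    (hf : HasFracLaplacianAt s f x l) : HasFracLaplacianAt s (fun y => -f y) x (-l) := by
  unfold HasFracLaplacianAt at *
  refine (Tendsto.neg hf).congr fun ε => ?_
  rw [← mul_neg, ← integral_neg]
  congr 2
  ext y
  ring

lemma PointwiseSolution.neg {N : ℕ} {s T : ℝ} {ρ : E N → ℝ} {u : E N → ℝ → ℝ}
    (hu : PointwiseSolution s T ρ u) : PointwiseSolution s T ρ (fun x t => -u x t) where
  continuousOn := hu.continuousOn.neg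
  differentiable x t ht := (hu.differentiable x t ht).neg
  equation x t ht := by
    have h := (hu.equation x t ht).neg
    have e : deriv (fun t => -u x t) t = -deriv (u x) t := deriv.fun_neg
    rwa [e, mul_neg]
  initial x := by simp [hu.initial x]

lemma PointwiseSolution.continuous_slice {N : ℕ} {s T : ℝ} {ρ : E N → ℝ} {u : E N → ℝ → ℝ}
    (hu : PointwiseSolution s T ρ u) {t : ℝ} (ht : t ∈ Icc 0 T) : Continuous fun y => u y t := by
  rw [← continuousOn_univ]
  exact hu.continuousOn.comp (f := fun y : E N => (y, t)) (by fun_prop) fun y _ => ⟨mem_univ _, ht⟩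

/-! ### The local maximum principle -/

/-- Only earlier times are compared, because the maximum may sit at the final time of the cylinder.
-/
lemma le_deriv_of_eventually_le_left {f : ℝ → ℝ} {f' c t₀ : ℝ} (hf : HasDerivAt f f' t₀)
    (h : ∀ᶠ t in 𝓝[<] t₀, c * (t₀ - t) ≤ f t₀ - f t) : c ≤ f' := by
  have hs : Tendsto (slope f t₀) (𝓝[<] t₀) (𝓝 f') :=
    hf.tendsto_slope.mono_left (nhdsWithin_mono _ fun t ht => ne_of_lt ht)
  refine ge_of_tendsto hs ?_
  filter_upwards [h, self_mem_nhdsWithin] with t ht htt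
  have htt : t < t₀ := htt
  rw [slope_comm, slope_def_field, le_div_iff₀ (by linarith)]
  exact ht

/-- A local maximum principle: a one-sided bound of `u` on a ball of radius `2r`, a lower bound of
the density on the ball of radius `r` and an integrable bound `g` for the tails of `u` control `u`
at the centre of the ball. -/
theorem PointwiseSolution.le_of_local_bounds {N : ℕ} (hN : 1 ≤ N) {s : ℝ} (hs0 : 0 < s)
    (hs1 : s < 1) {T : ℝ} {ρ : E N → ℝ} {u : E N → ℝ → ℝ} (hu : PointwiseSolution s T ρ u)
    {x₁ : E N} {r A m : ℝ} (hr : 0 < r) (hA0 : 0 ≤ A) (hm : 0 < m)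
    (hA : ∀ y, ‖y - x₁‖ ≤ 2 * r → ∀ t ∈ Ioo 0 T, u y t ≤ A)
    (hρ : ∀ y, ‖y - x₁‖ ≤ r → m ≤ ρ y)
    {g : ℝ → ℝ} (hg0 : ∀ t, 0 ≤ g t) (hgint : IntegrableOn g (Ioo 0 T))
    (hglsc : LowerSemicontinuousOn g (Ioo 0 T))
    (htail : ∀ x, ‖x - x₁‖ ≤ r → ∀ t ∈ Ioo 0 T,
      IntegrableOn (fun y => |u y t| / ‖x - y‖ ^ ((N : ℝ) + 2 * s)) {y | r ≤ ‖x - y‖} ∧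
      ∫ y in {y | r ≤ ‖x - y‖}, |u y t| / ‖x - y‖ ^ ((N : ℝ) + 2 * s) ≤ g t)
    {t : ℝ} (ht : t ∈ Ioo 0 T) :
    u x₁ t ≤ fracConst N s / m *
      (A / r ^ 2 * (quadConst N s * r ^ (2 - 2 * s)) * T + ∫ τ in Ioo 0 T, g τ) := by
  by_contra! hcon
  have hc := fracConst_pos N hs0 hs1
  have hq := quadConst_nonneg N hs1
  set lam := fracConst N s / m with hlam
  have hlam0 : 0 < lam := by positivity
  set B := A / r ^ 2 with hBdef
  have hB : 0 ≤ B := by positivity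
  have hBA : B * r ^ 2 = A := by rw [hBdef]; field_simp
  set k := B * (quadConst N s * r ^ (2 - 2 * s)) with hk
  have hk0 : 0 ≤ k := by positivity
  obtain ⟨ht0, htT⟩ := ht
  have hT : 0 < T := ht0.trans htT
  -- Half of the gap in the negated inequality, spread over time `T`, makes the barrier strict.
  obtain ⟨δ, hδ, hδu⟩ : ∃ δ : ℝ, 0 < δ ∧
      lam * (k * T + ∫ τ in Ioo 0 T, g τ) + δ * T < u x₁ t := by
    refine ⟨(u x₁ t - lam * (k * T + ∫ τ in Ioo 0 T, g τ)) / (2 * T), ?_, ?_⟩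
    · have := sub_pos.2 hcon
      positivity
    · have : (u x₁ t - lam * (k * T + ∫ τ in Ioo 0 T, g τ)) / (2 * T) * T =
        (u x₁ t - lam * (k * T + ∫ τ in Ioo 0 T, g τ)) / 2 := by field_simp
      rw [this]
      linarith
  have hgI : ∀ a b : ℝ, 0 ≤ a → a ≤ b → b < T → IntervalIntegrable g volume a b := by
    intro a b ha hab hb
    rw [intervalIntegrable_iff_integrableOn_Ioc_of_le hab]
    exact hgint.mono_set fun τ hτ => ⟨ha.trans_lt hτ.1, hτ.2.trans_lt hb⟩
  set G : ℝ → ℝ := fun τ => ∫ τ' in (0 : ℝ)..τ, g τ' with hG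
  have hG0 : ∀ τ, 0 ≤ τ → 0 ≤ G τ := fun τ hτ =>
    intervalIntegral.integral_nonneg hτ fun x _ => hg0 x
  have hGT : G t ≤ ∫ τ in Ioo 0 T, g τ := by
    simp only [hG]
    rw [intervalIntegral.integral_of_le ht0.le]
    exact setIntegral_mono_set hgint (.of_forall hg0)
      (LE.le.eventuallyLE fun τ hτ => ⟨hτ.1, hτ.2.trans_lt htT⟩)
  have hGc : ContinuousOn G (Icc 0 t) := by
    have := intervalIntegral.continuousOn_primitive_interval (a := 0) (b := t) (f := g)
      (μ := volume) (by
        rw [uIcc_of_le ht0.le, integrableOn_Icc_iff_integrableOn_Ioc]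
        exact hgint.mono_set fun τ hτ => ⟨hτ.1, hτ.2.trans_lt htT⟩)
    rwa [uIcc_of_le ht0.le] at this
  -- Since `m * lam = fracConst N s`, the barrier's growth in time `lam * (k + g)` balances exactly
  -- the lower bound of the fractional Laplacian.
  set w : E N × ℝ → ℝ := fun q =>
    u q.1 q.2 - B * ‖q.1 - x₁‖ ^ 2 - lam * (k * q.2 + G q.2) - δ * q.2 with hw
  set K : Set (E N × ℝ) := closedBall x₁ r ×ˢ Icc 0 t with hK
  have hKc : IsCompact K := (isCompact_closedBall x₁ r).prod isCompact_Icc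
  have hwc : ContinuousOn w K := by
    have h1 : ContinuousOn (fun q : E N × ℝ => u q.1 q.2) K :=
      hu.continuousOn.mono fun q hq => ⟨mem_univ _, hq.2.1, hq.2.2.trans htT.le⟩
    have h2 : ContinuousOn (fun q : E N × ℝ => G q.2) K :=
      hGc.comp (by fun_prop) fun q hq => hq.2
    exact ((h1.sub (by fun_prop)).sub
      (continuousOn_const.mul (ContinuousOn.add (by fun_prop) h2))).sub (by fun_prop)
  have hx₁K : (x₁, t) ∈ K := ⟨mem_closedBall_self hr.le, ht0.le, le_rfl⟩
  obtain ⟨⟨x₀, t₀⟩, hq0, hmax⟩ := hKc.exists_isMaxOn ⟨_, hx₁K⟩ hwc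
  have hw1 : 0 < w (x₁, t) := by
    simp only [hw, sub_self, norm_zero]
    have h1 : lam * (k * t + G t) ≤ lam * (k * T + ∫ τ in Ioo 0 T, g τ) := by gcongr
    have h2 : δ * t ≤ δ * T := by gcongr
    nlinarith
  have hw0 : 0 < w (x₀, t₀) := hw1.trans_le (hmax hx₁K)
  obtain ⟨hx0, ht00, ht0t⟩ := hq0
  simp only at ht00 ht0t
  have hx0' : ‖x₀ - x₁‖ ≤ r := by simpa [dist_eq_norm] using hx0
  have hGt0 := hG0 t₀ ht00
  have hbar : 0 ≤ lam * (k * t₀ + G t₀) + δ * t₀ := by positivity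
  have ht0pos : 0 < t₀ := by
    rcases ht00.eq_or_lt with h | h
    · exfalso
      subst h
      simp only [hw, hu.initial] at hw0
      have : 0 ≤ B * ‖x₀ - x₁‖ ^ 2 := by positivity
      linarith
    · exact h
  have ht0T : t₀ ∈ Ioo 0 T := ⟨ht0pos, ht0t.trans_lt htT⟩
  -- As `B * r ^ 2 = A`, the barrier dominates `u` on the annulus `r ≤ ‖y - x₁‖ ≤ 2r`. Hence the
  -- maximum over the inner ball persists on the ball of radius `r` about `x₀`, which may leave the
  -- inner ball.
  have houter : ∀ y, r ≤ ‖y - x₁‖ → ‖y - x₁‖ ≤ 2 * r → w (y, t₀) ≤ 0 := by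
    intro y h1 h2
    have hy := hA y h2 t₀ ht0T
    have : B * r ^ 2 ≤ B * ‖y - x₁‖ ^ 2 := by gcongr
    simp only [hw]
    linarith
  have hx0r : ‖x₀ - x₁‖ < r := by
    by_contra! h
    exact absurd hw0 (not_lt.2 (houter x₀ h (by linarith)))
  have hwmax : ∀ y, ‖x₀ - y‖ < r → w (y, t₀) ≤ w (x₀, t₀) := by
    intro y hy
    rcases le_or_gt ‖y - x₁‖ r with h | h
    · exact hmax (show (y, t₀) ∈ K from ⟨by simpa [dist_eq_norm] using h, ht00, ht0t⟩)
    · refine (houter y h.le ?_).trans hw0.le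
      have : ‖y - x₁‖ ≤ ‖y - x₀‖ + ‖x₀ - x₁‖ := norm_sub_le_norm_sub_add_norm_sub _ _ _
      rw [norm_sub_rev y x₀] at this
      linarith
  obtain ⟨htI, htG⟩ := htail x₀ hx0' t₀ ht0T
  have hlow := (hu.equation x₀ t₀ ht0T).lower_bound hN hs0 hs1 hr hB ((2 * B) • (x₀ - x₁))
    (fun y hy => by
      have h := hwmax y hy
      simp only [hw] at h
      have e : ‖y - x₁‖ ^ 2 =
          ‖x₀ - x₁‖ ^ 2 - 2 * inner ℝ (x₀ - x₁) (x₀ - y) + ‖x₀ - y‖ ^ 2 := by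
        rw [← norm_sub_sq_real]
        congr 2
        abel
      rw [e] at h
      rw [real_inner_smul_left]
      linarith)
    (by
      have : 0 ≤ B * ‖x₀ - x₁‖ ^ 2 := by positivity
      simp only [hw] at hw0
      linarith) htI htG
  have hup : ρ x₀ * deriv (u x₀) t₀ ≤ fracConst N s * (k + g t₀) := by
    rw [hk]
    linarith
  -- Lower semicontinuity only gives `g > M` near `t₀`; the loss, multiplied by `lam`, uses up half
  -- of `δ`.
  set M := g t₀ - δ / (2 * lam) with hM
  have hMlt : M < g t₀ := by
    have : 0 < δ / (2 * lam) := by positivity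
    linarith
  have hev : ∀ᶠ τ in 𝓝 t₀, M < g τ := by
    have := hglsc t₀ ht0T M hMlt
    rwa [isOpen_Ioo.nhdsWithin_eq ht0T] at this
  obtain ⟨η, hη, hηg⟩ := Metric.eventually_nhds_iff.1 hev
  have hder : lam * (k + M) + δ ≤ deriv (u x₀) t₀ := by
    refine le_deriv_of_eventually_le_left (hu.differentiable x₀ t₀ ht0T).hasDerivAt ?_
    have hlt : max 0 (t₀ - η) < t₀ := max_lt ht0pos (by linarith)
    filter_upwards [Ioo_mem_nhdsLT hlt] with τ hτ
    have hτ0 : 0 < τ := (le_max_left _ _).trans_lt hτ.1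
    have hτη : t₀ - η < τ := (le_max_right _ _).trans_lt hτ.1
    have hτt : τ < t₀ := hτ.2
    have h := hmax (show (x₀, τ) ∈ K from ⟨hx0, hτ0.le, hτt.le.trans ht0t⟩)
    have hGd : M * (t₀ - τ) ≤ G t₀ - G τ := by
      have e : G t₀ - G τ = ∫ τ' in τ..t₀, g τ' := by
        simp only [hG]
        rw [intervalIntegral.integral_interval_sub_left (hgI _ _ le_rfl ht00 ht0T.2)
          (hgI _ _ le_rfl hτ0.le (hτt.trans ht0T.2))]
      rw [e]
      have := intervalIntegral.integral_mono_on (a := τ) (b := t₀) (f := fun _ => M) (g := g)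
        hτt.le intervalIntegrable_const (hgI _ _ hτ0.le hτt.le ht0T.2) (fun z hz => (hηg (by
          rw [Real.dist_eq, abs_lt]
          constructor <;> linarith [hz.1, hz.2])).le)
      rw [intervalIntegral.integral_const, smul_eq_mul] at this
      linarith
    have h' : w (x₀, τ) ≤ w (x₀, t₀) := h
    simp only [hw] at h'
    have := mul_le_mul_of_nonneg_left hGd hlam0.le
    linarith
  have hlM : lam * (k + M) + δ = lam * (k + g t₀) + δ / 2 := by
    rw [hM]
    field_simp
    ring
  have hgt0 := hg0 t₀
  -- Positivity of the derivative is what allows `ρ` to be replaced by its lower bound `m`.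
  have hdpos : 0 < deriv (u x₀) t₀ := by
    refine lt_of_lt_of_le ?_ hder
    rw [hlM]
    positivity
  have h1 : m * deriv (u x₀) t₀ ≤ fracConst N s * (k + g t₀) :=
    (mul_le_mul_of_nonneg_right (hρ x₀ hx0') hdpos.le).trans hup
  have h2 : fracConst N s = m * lam := by rw [hlam]; field_simp
  rw [h2, mul_assoc] at h1
  have h3 := le_of_mul_le_mul_left h1 hm
  linarith

/-! ### Densities with `α ≥ 0`: letting the radius tend to infinity -/

lemma one_add_sq_rpow_half_le {a b e : ℝ} (ha : 0 ≤ a) (he : 0 ≤ e) (hab : 1 + a ≤ b) :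
    (1 + a ^ 2) ^ (e / 2) ≤ b ^ e := by
  have hb : 0 ≤ b := by linarith
  calc (1 + a ^ 2) ^ (e / 2) ≤ (b ^ 2) ^ (e / 2) :=
        Real.rpow_le_rpow (by positivity) (by nlinarith) (by positivity)
    _ = b ^ e := by
        rw [← Real.rpow_natCast, ← Real.rpow_mul hb]
        congr 1
        push_cast
        ring

/-- For `α ≥ 0`, solutions of growth `σ < 2s - α` are nonpositive. -/
theorem PointwiseSolution.nonpos_of_growth {N : ℕ} (hN : 1 ≤ N) {s : ℝ} (hs0 : 0 < s) (hs1 : s < 1)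
    {T : ℝ} {ρ : E N → ℝ} {u : E N → ℝ → ℝ} (hu : PointwiseSolution s T ρ u)
    {α K : ℝ} (hα : 0 ≤ α) (hK : 0 < K) (hρ : ∀ x, K * (1 + ‖x‖ ^ 2) ^ (-α / 2) ≤ ρ x)
    {σ C : ℝ} (hσ : 0 ≤ σ) (hσα : σ + α < 2 * s) (hC : 0 ≤ C)
    (hbd : ∀ x : E N, ∀ t ∈ Ioo 0 T, |u x t| ≤ C * (1 + ‖x‖ ^ 2) ^ (σ / 2))
    (x₁ : E N) {t : ℝ} (ht : t ∈ Ioo 0 T) : u x₁ t ≤ 0 := by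
  set p : ℝ := (N : ℝ) + 2 * s with hp
  set V : ℝ := N * volume.real (ball (0 : E N) 1) with hV
  have hT : 0 < T := ht.1.trans ht.2
  -- For `r ≥ 1 + ‖x₁‖`, points of the ball of radius `2r` satisfy `1 + ‖y‖ ≤ 3r`, and points of the
  -- tail satisfy `1 + ‖y‖ ≤ 3‖x - y‖`; hence the factors `3`.
  have key : ∀ r : ℝ, 1 + ‖x₁‖ ≤ r → u x₁ t ≤
      fracConst N s / K * 3 ^ α * (C * 3 ^ σ * quadConst N s * T +
        C * 3 ^ σ * (V / -(σ - 2 * s)) * T) * r ^ (-(2 * s - (σ + α))) := by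
    intro r hr
    have hr0 : 0 < r := lt_of_lt_of_le (by positivity) hr
    have hgrow : ∀ y : E N, ∀ a, 1 + ‖y‖ ≤ 3 * a → ∀ t ∈ Ioo 0 T, |u y t| ≤ C * (3 * a) ^ σ := by
      intro y a hya t ht
      refine (hbd y t ht).trans (mul_le_mul_of_nonneg_left ?_ hC)
      exact one_add_sq_rpow_half_le (norm_nonneg y) hσ hya
    obtain ⟨hint, hval⟩ := integral_compl_ball_norm_rpow hN (a := σ - 2 * s) (by linarith) hr0
    set F : E N → ℝ := fun z => C * 3 ^ σ * ‖z‖ ^ (σ - 2 * s - N) with hF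
    have h := hu.le_of_local_bounds hN hs0 hs1 (x₁ := x₁) (r := r) (A := C * (3 * r) ^ σ)
      (m := K * (3 * r) ^ (-α)) (g := fun _ => C * 3 ^ σ * (V * (r ^ (σ - 2 * s) / -(σ - 2 * s))))
      hr0 (by positivity) (by positivity) ?_ ?_ ?_ ?_ ?_ ?_ ht
    · refine h.trans_eq ?_
      rw [setIntegral_const, smul_eq_mul, measureReal_def, Real.volume_Ioo, sub_zero,
        ENNReal.toReal_ofReal hT.le, Real.mul_rpow (by norm_num) hr0.le,
        Real.mul_rpow (by norm_num) hr0.le, Real.rpow_neg (by norm_num), Real.rpow_neg hr0.le]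
      have e1 : r ^ (-(2 * s - (σ + α))) = r ^ σ * r ^ α / r ^ (2 * s) := by
        rw [← Real.rpow_add hr0, ← Real.rpow_sub hr0]
        congr 1
        ring
      have e2 : r ^ (2 - 2 * s) = r ^ 2 / r ^ (2 * s) := by
        rw [Real.rpow_sub hr0, Real.rpow_ofNat]
      rw [e1, e2, Real.rpow_sub hr0]
      have : -(σ - 2 * s) ≠ 0 := by
        have : 0 < -(σ - 2 * s) := by linarith
        exact this.ne'
      have := (Real.rpow_pos_of_pos hr0 α).ne'
      have := (Real.rpow_pos_of_pos hr0 (2 * s)).ne'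
      have := (Real.rpow_pos_of_pos (by norm_num : (0 : ℝ) < 3) α).ne'
      field_simp
    · intro y hy t ht
      refine (le_abs_self _).trans (hgrow y r ?_ t ht)
      have : ‖y‖ ≤ ‖y - x₁‖ + ‖x₁‖ := by simpa using norm_add_le (y - x₁) x₁
      linarith
    · intro y hy
      refine le_trans (mul_le_mul_of_nonneg_left ?_ hK.le) (hρ y)
      have : ‖y‖ ≤ ‖y - x₁‖ + ‖x₁‖ := by simpa using norm_add_le (y - x₁) x₁
      rw [neg_div, Real.rpow_neg (by positivity), Real.rpow_neg (by positivity)]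
      refine inv_anti₀ (by positivity) ?_
      exact one_add_sq_rpow_half_le (norm_nonneg y) hα (by linarith)
    · intro τ
      have : 0 < -(σ - 2 * s) := by linarith
      positivity
    · exact integrableOn_const (by simp)
    · exact continuousOn_const.lowerSemicontinuousOn
    · intro x hx t ht
      have hmeas : MeasurableSet {y : E N | r ≤ ‖x - y‖} :=
        measurableSet_le measurable_const (by fun_prop)
      have hle : ∀ y ∈ {y : E N | r ≤ ‖x - y‖}, |u y t| / ‖x - y‖ ^ p ≤ F (x - y) := by
        intro y hy
        have hy : r ≤ ‖x - y‖ := hy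
        have hpos : 0 < ‖x - y‖ := hr0.trans_le hy
        have h1 : ‖y‖ ≤ ‖x - y‖ + ‖x‖ := by
          simpa [norm_sub_rev] using norm_add_le (y - x) x
        have h2 : ‖x‖ ≤ ‖x - x₁‖ + ‖x₁‖ := by simpa using norm_add_le (x - x₁) x₁
        have h3 := hgrow y ‖x - y‖ (by linarith) t ht
        rw [div_le_iff₀ (by positivity)]
        refine h3.trans_eq ?_
        simp only [hF]
        rw [Real.mul_rpow (by norm_num) hpos.le, mul_assoc (C * 3 ^ σ), ← Real.rpow_add hpos,
          mul_assoc]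
        congr 3
        rw [hp]
        ring
      have hFint : IntegrableOn (fun y => F (x - y)) {y : E N | r ≤ ‖x - y‖} :=
        integrableOn_comp_sub_left x (Ici r) measurableSet_Ici (hint.const_mul _)
      have huc := hu.continuous_slice (Ioo_subset_Icc_self ht)
      have hI : IntegrableOn (fun y => |u y t| / ‖x - y‖ ^ p) {y | r ≤ ‖x - y‖} := by
        refine Integrable.mono' hFint ?_ ?_
        · have : Measurable fun y : E N => ‖x - y‖ := by fun_prop
          exact (huc.abs.measurable.div (this.pow_const p)).aestronglyMeasurable
        · refine (ae_restrict_iff' hmeas).2 (.of_forall fun y hy => ?_)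
          rw [Real.norm_of_nonneg (by positivity)]
          exact hle y hy
      refine ⟨hI, (setIntegral_mono_on hI hFint hmeas hle).trans_eq ?_⟩
      have := setIntegral_comp_sub_left x (Ici r) measurableSet_Ici F
      simp only [mem_Ici] at this hval
      rw [this, hF, integral_const_mul, hval]
  have hlim := (tendsto_rpow_neg_atTop (y := 2 * s - (σ + α)) (by linarith)).const_mul
    (fracConst N s / K * 3 ^ α * (C * 3 ^ σ * quadConst N s * T +
        C * 3 ^ σ * (V / -(σ - 2 * s)) * T))
  rw [mul_zero] at hlim
  exact ge_of_tendsto hlim ((eventually_ge_atTop _).mono key)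

theorem PointwiseSolution.eq_zero_of_growth {N : ℕ} (hN : 1 ≤ N) {s : ℝ} (hs0 : 0 < s) (hs1 : s < 1)
    {T : ℝ} {ρ : E N → ℝ} {u : E N → ℝ → ℝ} (hu : PointwiseSolution s T ρ u)
    {α K : ℝ} (hα : 0 ≤ α) (hK : 0 < K) (hρ : ∀ x, K * (1 + ‖x‖ ^ 2) ^ (-α / 2) ≤ ρ x)
    {σ C : ℝ} (hσ : 0 ≤ σ) (hσα : σ + α < 2 * s) (hC : 0 ≤ C)
    (hbd : ∀ x : E N, ∀ t ∈ Ioo 0 T, |u x t| ≤ C * (1 + ‖x‖ ^ 2) ^ (σ / 2))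
    (x : E N) {t : ℝ} (ht : t ∈ Ioo 0 T) : u x t = 0 := by
  have h1 := hu.nonpos_of_growth hN hs0 hs1 hα hK hρ hσ hσα hC hbd x ht
  have h2 := hu.neg.nonpos_of_growth hN hs0 hs1 hα hK hρ hσ hσα hC
    (fun y τ hτ => by rw [abs_neg]; exact hbd y τ hτ) x ht
  linarith

/-! ### Densities with `α ≤ 0`: boundedness through the `𝓛^s` norm -/

/-- The norm of `u(·, t)` in `𝓛^s(ℝ^N)`. -/
def sliceNorm {N : ℕ} (s : ℝ) (u : E N → ℝ → ℝ) (t : ℝ) : ℝ :=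
  ∫ y : E N, |u y t| / (1 + ‖y‖ ^ ((N : ℝ) + 2 * s))

lemma sliceNorm_nonneg {N : ℕ} (s : ℝ) (u : E N → ℝ → ℝ) (t : ℝ) : 0 ≤ sliceNorm s u t :=
  integral_nonneg fun y => by positivity

/-- Fatou's lemma along a sequence of times, using pointwise continuity in `t`. This is the
regularity in time that the maximum principle asks of its tail bound. -/
lemma lowerSemicontinuousOn_sliceNorm {N : ℕ} {s T : ℝ} {u : E N → ℝ → ℝ}
    (hc : ContinuousOn (Function.uncurry u) (closedStrip N T))
    (hL : ∀ t ∈ Ioo 0 T, MemL s fun x => u x t) :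
    LowerSemicontinuousOn (sliceNorm s u) (Ioo 0 T) := by
  intro t₀ ht₀ M hM
  have hden : ∀ y : E N, 0 < 1 + ‖y‖ ^ ((N : ℝ) + 2 * s) := fun y => by positivity
  rcases lt_or_ge M 0 with hM0 | hM0
  · exact .of_forall fun t => hM0.trans_le (sliceNorm_nonneg s u t)
  have hlin : ∀ t ∈ Ioo 0 T, ENNReal.ofReal (sliceNorm s u t) =
      ∫⁻ y : E N, ENNReal.ofReal (|u y t| / (1 + ‖y‖ ^ ((N : ℝ) + 2 * s))) := fun t ht =>
    ofReal_integral_eq_lintegral_ofReal (hL t ht).2 (.of_forall fun y => by positivity)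
  have hslice : ∀ t ∈ Ioo 0 T, Continuous fun y => u y t := fun t ht => by
    rw [← continuousOn_univ]
    exact hc.comp (f := fun y : E N => (y, t)) (by fun_prop)
      fun y _ => ⟨mem_univ _, Ioo_subset_Icc_self ht⟩
  by_contra hcon
  rw [not_eventually] at hcon
  obtain ⟨τ, hτ, hτM⟩ := exists_seq_forall_of_frequently (hcon.and_eventually self_mem_nhdsWithin)
  have hτ0 : Tendsto τ atTop (𝓝 t₀) := hτ.mono_right nhdsWithin_le_nhds
  have hfatou := lintegral_liminf_le (μ := volume) (u := atTop) (f := fun n : ℕ => fun y : E N =>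
    ENNReal.ofReal (|u y (τ n)| / (1 + ‖y‖ ^ ((N : ℝ) + 2 * s)))) (fun n => by
      have := (hslice _ (hτM n).2).abs.measurable
      fun_prop)
  have hpt : ∀ y : E N, liminf (fun n : ℕ =>
      ENNReal.ofReal (|u y (τ n)| / (1 + ‖y‖ ^ ((N : ℝ) + 2 * s)))) atTop =
      ENNReal.ofReal (|u y t₀| / (1 + ‖y‖ ^ ((N : ℝ) + 2 * s))) := by
    intro y
    refine Tendsto.liminf_eq ?_
    have h1 : ContinuousOn (u y) (Icc 0 T) :=
      hc.comp (f := fun t : ℝ => (y, t)) (by fun_prop) fun t ht => ⟨mem_univ _, ht⟩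
    have h2 : Tendsto (fun n => u y (τ n)) atTop (𝓝 (u y t₀)) :=
      (h1.continuousAt (Icc_mem_nhds ht₀.1 ht₀.2)).tendsto.comp hτ0
    exact ENNReal.tendsto_ofReal (h2.abs.div_const _)
  simp_rw [hpt] at hfatou
  rw [← hlin t₀ ht₀] at hfatou
  have hle : liminf (fun n : ℕ => ∫⁻ y : E N,
      ENNReal.ofReal (|u y (τ n)| / (1 + ‖y‖ ^ ((N : ℝ) + 2 * s)))) atTop ≤ ENNReal.ofReal M := by
    refine liminf_le_of_frequently_le' (.of_forall fun n => ?_)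
    rw [← hlin _ (hτM n).2]
    exact ENNReal.ofReal_le_ofReal (not_lt.1 (hτM n).1)
  exact absurd ((ENNReal.ofReal_le_ofReal_iff hM0).1 (hfatou.trans hle)) (not_le.2 hM)

lemma MemL1L.integrableOn_sliceNorm {N : ℕ} {s T : ℝ} {u : E N → ℝ → ℝ} (h : MemL1L s T u) :
    IntegrableOn (sliceNorm s u) (Ioo 0 T) := by
  have h2 := h.2
  unfold IntegrableOn strip at h2
  rw [Measure.volume_eq_prod, ← Measure.prod_restrict, Measure.restrict_univ] at h2
  exact h2.integral_prod_right

lemma one_add_rpow_le {a b e : ℝ} (ha : 0 ≤ a) (he : 0 ≤ e) (hab : 1 + a ≤ b) :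
    1 + a ^ e ≤ 2 * b ^ e := by
  have h1 : (1 : ℝ) ≤ b ^ e := Real.one_le_rpow (by linarith) he
  have h2 : a ^ e ≤ b ^ e := Real.rpow_le_rpow ha (by linarith) he
  linarith

/-- For `α ≤ 0`, solutions of growth `σ < 2s - α` in `L¹((0, T), 𝓛^s)` are bounded above. -/
theorem PointwiseSolution.bddAbove_of_growth {N : ℕ} (hN : 1 ≤ N) {s : ℝ} (hs0 : 0 < s)
    (hs1 : s < 1) {T : ℝ} {ρ : E N → ℝ} {u : E N → ℝ → ℝ} (hu : PointwiseSolution s T ρ u)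
    (hL : ∀ t ∈ Ioo 0 T, MemL s fun x => u x t) (hL1 : IntegrableOn (sliceNorm s u) (Ioo 0 T))
    {α K : ℝ} (hα : α ≤ 0) (hK : 0 < K) (hρ : ∀ x, K * (1 + ‖x‖ ^ 2) ^ (-α / 2) ≤ ρ x)
    {σ C : ℝ} (hσ : 0 ≤ σ) (hσα : σ + α < 2 * s) (hC : 0 ≤ C)
    (hbd : ∀ x : E N, ∀ t ∈ Ioo 0 T, |u x t| ≤ C * (1 + ‖x‖ ^ 2) ^ (σ / 2)) :
    ∃ M, ∀ x, ∀ t ∈ Ioo 0 T, u x t ≤ M := by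
  set p : ℝ := (N : ℝ) + 2 * s with hp
  set I : ℝ := ∫ τ in Ioo 0 T, sliceNorm s u τ with hI
  have hI0 : 0 ≤ I := integral_nonneg fun t => sliceNorm_nonneg s u t
  have hc := fracConst_pos N hs0 hs1
  have hq := quadConst_nonneg N hs1
  -- The value at `r = 1/4` of the estimate below: `r ≥ 1/4` always, and both exponents `σ + α - 2s`
  -- and `α` are nonpositive.
  refine ⟨fracConst N s / K * (C * 6 ^ σ * quadConst N s * T * (1 / 4) ^ (σ + α - 2 * s) +
    2 * 6 ^ p * I * (1 / 4) ^ α), fun x₁ t ht => ?_⟩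
  have hT : 0 < T := ht.1.trans ht.2
  -- With this radius, `‖y - x₁‖ ≤ r` forces `‖y‖ ≥ 3r - 1`, hence `1 + ‖y‖² ≥ r²` and `ρ ≥ K
  -- r^(-α)`. Moreover `1 + ‖y‖ ≤ 6r` on the ball of radius `2r` and `1 + ‖y‖ ≤ 6‖x - y‖` in the
  -- tail.
  obtain ⟨r, hr⟩ : ∃ r : ℝ, r = (1 + ‖x₁‖) / 4 := ⟨_, rfl⟩
  have hx₁ : ‖x₁‖ = 4 * r - 1 := by rw [hr]; ring
  have hr4 : 1 / 4 ≤ r := by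
    have := norm_nonneg x₁
    linarith
  have hr0 : 0 < r := by linarith
  have h := hu.le_of_local_bounds hN hs0 hs1 (x₁ := x₁) (r := r) (A := C * (6 * r) ^ σ)
      (m := K * r ^ (-α)) (g := fun t => 2 * 6 ^ p * sliceNorm s u t)
      hr0 (by positivity) (by positivity) ?_ ?_ ?_ ?_ ?_ ?_ ht
  · rw [integral_const_mul] at h
    refine h.trans ?_
    have e1 : fracConst N s / (K * r ^ (-α)) * (C * (6 * r) ^ σ / r ^ 2 *
        (quadConst N s * r ^ (2 - 2 * s)) * T + 2 * 6 ^ p * I) =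
        fracConst N s / K * (C * 6 ^ σ * quadConst N s * T * r ^ (σ + α - 2 * s) +
          2 * 6 ^ p * I * r ^ α) := by
      rw [Real.mul_rpow (by norm_num) hr0.le, Real.rpow_neg hr0.le, Real.rpow_sub hr0 2,
        Real.rpow_ofNat, Real.rpow_sub hr0, Real.rpow_add hr0]
      have := (Real.rpow_pos_of_pos hr0 α).ne'
      have := (Real.rpow_pos_of_pos hr0 (2 * s)).ne'
      field_simp
    rw [e1]
    have h1 : r ^ (σ + α - 2 * s) ≤ (1 / 4) ^ (σ + α - 2 * s) :=
      Real.rpow_le_rpow_of_nonpos (by norm_num) hr4 (by linarith)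
    have h2 : r ^ α ≤ (1 / 4) ^ α := Real.rpow_le_rpow_of_nonpos (by norm_num) hr4 hα
    gcongr
  · intro y hy t ht
    refine (le_abs_self _).trans ((hbd y t ht).trans (mul_le_mul_of_nonneg_left ?_ hC))
    have : ‖y‖ ≤ ‖y - x₁‖ + ‖x₁‖ := by simpa using norm_add_le (y - x₁) x₁
    exact one_add_sq_rpow_half_le (norm_nonneg y) hσ (by linarith)
  · intro y hy
    refine le_trans (mul_le_mul_of_nonneg_left ?_ hK.le) (hρ y)
    have h1 : ‖x₁‖ ≤ ‖y‖ + ‖y - x₁‖ := by simpa using norm_sub_le y (y - x₁)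
    have h2 : r ^ 2 ≤ 1 + ‖y‖ ^ 2 := by nlinarith [norm_nonneg y, sq_nonneg (1 - ‖y‖)]
    have e : r ^ (-α) = (r ^ 2) ^ (-α / 2) := by
      rw [← Real.rpow_natCast, ← Real.rpow_mul hr0.le]
      congr 1
      push_cast
      ring
    rw [e]
    exact Real.rpow_le_rpow (by positivity) h2 (by linarith)
  · intro τ
    have := sliceNorm_nonneg s u τ
    positivity
  · exact hL1.const_mul _
  · intro t₀ ht₀ M hM
    have hpos : (0 : ℝ) < 2 * 6 ^ p := by positivity
    have hlsc := lowerSemicontinuousOn_sliceNorm hu.continuousOn hL t₀ ht₀ (M / (2 * 6 ^ p))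
      ((div_lt_iff₀' hpos).2 hM)
    exact hlsc.mono fun τ hτ => (div_lt_iff₀' hpos).1 hτ
  · intro x hx t ht
    have hmeas : MeasurableSet {y : E N | r ≤ ‖x - y‖} :=
      measurableSet_le measurable_const (by fun_prop)
    have hle : ∀ y ∈ {y : E N | r ≤ ‖x - y‖}, |u y t| / ‖x - y‖ ^ p ≤
        2 * 6 ^ p * (|u y t| / (1 + ‖y‖ ^ p)) := by
      intro y hy
      have hy : r ≤ ‖x - y‖ := hy
      have hpos : 0 < ‖x - y‖ := hr0.trans_le hy
      have h1 : ‖y‖ ≤ ‖x - y‖ + ‖x‖ := by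
        simpa [norm_sub_rev] using norm_add_le (y - x) x
      have h2 : ‖x‖ ≤ ‖x - x₁‖ + ‖x₁‖ := by simpa using norm_add_le (x - x₁) x₁
      have h3 := one_add_rpow_le (b := 6 * ‖x - y‖) (norm_nonneg y) (by positivity : 0 ≤ p)
        (by linarith)
      rw [Real.mul_rpow (by norm_num) hpos.le] at h3
      rw [mul_div_assoc', div_le_div_iff₀ (by positivity) (by positivity)]
      calc |u y t| * (1 + ‖y‖ ^ p) ≤ |u y t| * (2 * (6 ^ p * ‖x - y‖ ^ p)) := by gcongr
        _ = _ := by ring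
    have hFint : Integrable fun y : E N => 2 * 6 ^ p * (|u y t| / (1 + ‖y‖ ^ p)) :=
      (hL t ht).2.const_mul _
    have huc := hu.continuous_slice (Ioo_subset_Icc_self ht)
    have hint : IntegrableOn (fun y => |u y t| / ‖x - y‖ ^ p) {y | r ≤ ‖x - y‖} := by
      refine Integrable.mono' hFint.integrableOn ?_ ?_
      · have : Measurable fun y : E N => ‖x - y‖ := by fun_prop
        exact (huc.abs.measurable.div (this.pow_const p)).aestronglyMeasurable
      · refine (ae_restrict_iff' hmeas).2 (.of_forall fun y hy => ?_)
        rw [Real.norm_of_nonneg (by positivity)]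
        exact hle y hy
    refine ⟨hint, (setIntegral_mono_on hint hFint.integrableOn hmeas hle).trans ?_⟩
    refine (setIntegral_le_integral hFint (.of_forall fun y => by positivity)).trans_eq ?_
    rw [integral_const_mul]
    rfl

/-! ### Uniqueness -/

/-- Solutions whose growth is of order less than `2s - α` vanish. -/
theorem IsSolution.eq_zero_of_growth {N : ℕ} (hN : 1 ≤ N) {s : ℝ} (hs0 : 0 < s) (hs1 : s < 1)
    {T : ℝ} {ρ : E N → ℝ} {α : ℝ} (hρ : DensityAssumption ρ α) {u : E N → ℝ → ℝ}
    (hu : IsSolution s T ρ u) {σ C : ℝ} (hσ : 0 ≤ σ) (hσα : σ + α < 2 * s) (hC : 0 ≤ C)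
    (hbd : ∀ x : E N, ∀ t ∈ Ioo 0 T, |u x t| ≤ C * (1 + ‖x‖ ^ 2) ^ (σ / 2))
    (x : E N) {t : ℝ} (ht : t ∈ Ioo 0 T) : u x t = 0 := by
  obtain ⟨K, hK, hKρ⟩ := hρ.lower_bound
  rcases le_total 0 α with hα | hα
  · exact hu.pointwise.eq_zero_of_growth hN hs0 hs1 hα hK hKρ hσ hσα hC hbd x ht
  have hL : ∀ t ∈ Ioo 0 T, MemL s fun x => u x t := fun t ht =>
    hu.solves.memL t (Ioo_subset_Ioc_self ht)
  have hL1 := hu.memL1L.integrableOn_sliceNorm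
  have hneg : sliceNorm s (fun x t => -u x t) = sliceNorm s u := by
    ext t
    simp only [sliceNorm, abs_neg]
  obtain ⟨M₁, hM₁⟩ := hu.pointwise.bddAbove_of_growth hN hs0 hs1 hL hL1 hα hK hKρ hσ hσα hC hbd
  obtain ⟨M₂, hM₂⟩ := hu.pointwise.neg.bddAbove_of_growth hN hs0 hs1
    (fun t ht => ⟨(hL t ht).1.neg, by simpa only [abs_neg] using (hL t ht).2⟩)
    (hneg ▸ hL1) hα hK hKρ hσ hσα hC
    (fun y τ hτ => by rw [abs_neg]; exact hbd y τ hτ)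
  refine hu.pointwise.eq_zero_of_growth hN hs0 hs1 (α := 0) (σ := 0) (C := max (max M₁ M₂) 0) le_rfl
    hK (fun y => ?_) le_rfl (by linarith) (le_max_right _ _) (fun y τ hτ => ?_) x ht
  · refine le_trans (mul_le_mul_of_nonneg_left ?_ hK.le) (hKρ y)
    rw [neg_zero, zero_div, Real.rpow_zero]
    exact Real.one_le_rpow (by nlinarith [sq_nonneg ‖y‖]) (by linarith)
  · rw [zero_div, Real.rpow_zero, mul_one, abs_le]
    have h1 := hM₁ y τ hτ
    have h2 := hM₂ y τ hτ
    have h3 := le_max_left M₁ M₂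
    have h4 := le_max_right M₁ M₂
    have h5 := le_max_left (max M₁ M₂) 0
    constructor <;> linarith

end FracParabolic

end

theorem corollary2p6 (N : ℕ) (hN : 1 ≤ N) (s : ℝ) (hs0 : 0 < s) (hs1 : s < 1)
    (T : ℝ) (hT : 0 < T) (ρ : FracParabolic.E N → ℝ) (α : ℝ)
    (hρ : FracParabolic.DensityAssumption ρ α) (hα : α < 2 * s)
    (u : FracParabolic.E N → ℝ → ℝ) (hu : FracParabolic.IsSolution s T ρ u) :
    (∀ σ ∈ Set.Ioo 0 (2 * s - α), ∀ C : ℝ, 0 < C →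
      (∀ x : FracParabolic.E N, ∀ t ∈ Set.Ioo 0 T, |u x t| ≤ C * (1 + ‖x‖ ^ 2) ^ (σ / 2)) →
      ∀ x : FracParabolic.E N, ∀ t ∈ Set.Ioo 0 T, u x t = 0) ∧
    ((∃ M : ℝ, ∀ x : FracParabolic.E N, ∀ t ∈ Set.Ioo 0 T, |u x t| ≤ M) →
      ∀ x : FracParabolic.E N, ∀ t ∈ Set.Ioo 0 T, u x t = 0) := by
  have key : ∀ σ ∈ Set.Ioo 0 (2 * s - α), ∀ C : ℝ, 0 < C →
      (∀ x : FracParabolic.E N, ∀ t ∈ Set.Ioo 0 T, |u x t| ≤ C * (1 + ‖x‖ ^ 2) ^ (σ / 2)) →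
      ∀ x : FracParabolic.E N, ∀ t ∈ Set.Ioo 0 T, u x t = 0 := fun σ hσ C hC hbd x t ht =>
    hu.eq_zero_of_growth hN hs0 hs1 hρ hσ.1.le (by linarith [hσ.2]) hC.le hbd x ht
  refine ⟨key, ?_⟩
  rintro ⟨M, hM⟩
  -- Any exponent in the open interval serves, since `1 + ‖x‖² ≥ 1`; `max M 1` makes the constant
  -- positive.
  refine key ((2 * s - α) / 2) ⟨by linarith, by linarith⟩ (max M 1) (by positivity)
    fun x t ht => (hM x t ht).trans ?_
  have h : (1 : ℝ) ≤ (1 + ‖x‖ ^ 2) ^ ((2 * s - α) / 2 / 2) :=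
    Real.one_le_rpow (by nlinarith [sq_nonneg ‖x‖]) (by linarith)
  exact (le_max_left M 1).trans (le_mul_of_one_le_right (by positivity) h)
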